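/- Let $\Phi$ be the distribution function of the standard normal law, let $\Lambda(x)=\exp(-e^{-x})$, $x\in\mathbb{R}$, be the Gumbel distribution function, and for integers $n\ge 2$ put $$b_n=\Phi^{-1}\Big(1-\frac1n\Big),\qquad a^\circ_n=\frac{b_n}{1+b_n^2}.$$ For integers $n_0\ge 5$ define $$C(n_0)=\begin{cases}1, & n_0\le 15,\\[1mm] \Big(\dfrac{2}{3b_{n_0}^2}+\dfrac{1}{\sqrt{e}\,n_0}\Big)\log n_0, & n_0\ge 16.\end{cases}$$ Then for every integer $n_0\ge 5$ and every integer $n\ge n_0$, $$\sup_{x\in\mathbb{R}}\big|\Phi^n(a^\circ_n x+b_n)-\Lambda(x)\big|<\frac{C(n_0)}{\log n},$$ where $\Phi^n(y)=(\Phi(y))^n$. Moreover $C(n_0)<1$ for every $n_0\ge 16$, and $\lim_{n_0\to\infty}C(n_0)=1/3$. -/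

import Mathlib

open Filter Topology

noncomputable section

/-- The distribution function `Φ` of the standard normal law. -/
def stdNormalCdf (x : ℝ) : ℝ :=
  ProbabilityTheory.cdf (ProbabilityTheory.gaussianReal 0 1) x

/-- The Gumbel distribution function `Λ(x) = exp(-e^{-x})`. -/
def gumbelCdf (x : ℝ) : ℝ := Real.exp (-Real.exp (-x))

/-- The inverse function `Φ⁻¹`. As `Φ` is a strictly increasing bijection of `ℝ` onto `(0, 1)`,
`Φ⁻¹(p)` is the unique `x` with `Φ(x) = p` for `0 < p < 1`; other arguments are not used. -/
def stdNormalCdfInv : ℝ → ℝ := Function.invFun stdNormalCdf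

/-- The location constant `b_n = Φ⁻¹(1 - 1/n)` (for `n ≥ 2`). -/
def normB (n : ℕ) : ℝ := stdNormalCdfInv (1 - 1 / (n : ℝ))

/-- The scale constant `a°_n = b_n / (1 + b_n²)`. -/
def normA (n : ℕ) : ℝ := normB n / (1 + normB n ^ 2)

/-- The constant `C(n₀)` of the error bound. -/
def rateC (n₀ : ℕ) : ℝ :=
  if n₀ ≤ 15 then 1
  else (2 / (3 * normB n₀ ^ 2) + 1 / (Real.sqrt (Real.exp 1) * (n₀ : ℝ))) * Real.log (n₀ : ℝ)

/-- The pointwise error `|Φ(a°_n x + b_n)^n - Λ(x)|`. -/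
def gumbelError (n : ℕ) (x : ℝ) : ℝ :=
  |stdNormalCdf (normA n * x + normB n) ^ n - gumbelCdf x|

end

noncomputable section

/-! Write `H = cumHazard = -log (1 - Φ)`, with derivative `h = hazard`. As `H(b_n) = log n`, one has
`n (1 - Φ(a x + b_n)) = exp (-D(x))` with `D = tailDecrement b_n`. The error is thus at most a
Poissonization error `|(1 - q)^n - exp (-n q)| ≤ 4 e⁻² / n`, plus `|exp (-exp (-D x)) - exp (-exp
(-x))|`. Tail inequalities give `0 < h' = h (h - t) < 1`, so `D(x)` lies between `η x` and `η x + a²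
x² / 2`, where `η = a h(b)` satisfies `0 ≤ 1 - η ≤ 2 / ((b² + 1)(b² + 2))`. As `a² ≤ 1 / b²`, the
second error is at most `0.6 / b²` for `n ≥ 16`. Since `0.6 < 2/3` and `4 e⁻² < 1 / √e`, this gives
`C(n) / log n`; a cruder estimate covers `5 ≤ n ≤ 15`. Finally `log n = H(b_n)` rewrites `C(n)`
through `H(t) / t²`, which decreases to `1/2` (`antitoneOn_cumHazard_div_sq`,
`tendsto_cumHazard_div_sq`), and `log n / n`. Hence `C` decreases to `1/3`, and `C < 1` need only be
checked at 16. -/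

/-- The density of the standard normal law. -/
def stdNormalPdf (t : ℝ) : ℝ := (Real.sqrt (2 * Real.pi))⁻¹ * Real.exp (-t ^ 2 / 2)

/-- The upper tail `1 - Φ` of the standard normal law. -/
def stdNormalTail (t : ℝ) : ℝ := 1 - stdNormalCdf t

/-- The hazard rate of the standard normal law. -/
def hazard (t : ℝ) : ℝ := stdNormalPdf t / stdNormalTail t

/-- The cumulative hazard `-log (1 - Φ)` of the standard normal law. -/
def cumHazard (t : ℝ) : ℝ := -Real.log (stdNormalTail t)

/-! ### The standard normal distribution function and tail. -/

lemma stdNormalPdf_pos (t : ℝ) : 0 < stdNormalPdf t := by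
  unfold stdNormalPdf
  have := Real.pi_pos
  positivity

lemma gaussianPDFReal_zero_one_eq :
    ProbabilityTheory.gaussianPDFReal 0 1 = stdNormalPdf := by
  funext t
  simp [ProbabilityTheory.gaussianPDFReal, stdNormalPdf]

lemma continuous_stdNormalPdf : Continuous stdNormalPdf := by
  unfold stdNormalPdf
  fun_prop

lemma integrable_stdNormalPdf : MeasureTheory.Integrable stdNormalPdf :=
  gaussianPDFReal_zero_one_eq ▸ ProbabilityTheory.integrable_gaussianPDFReal 0 1

lemma stdNormalCdf_eq_integral (t : ℝ) :
    stdNormalCdf t = ∫ x in Set.Iic t, stdNormalPdf x := by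
  unfold stdNormalCdf
  rw [ProbabilityTheory.cdf_eq_real, MeasureTheory.measureReal_def,
    ProbabilityTheory.gaussianReal_apply_eq_integral 0 one_ne_zero, gaussianPDFReal_zero_one_eq,
    ENNReal.toReal_ofReal]
  exact MeasureTheory.integral_nonneg fun x => (stdNormalPdf_pos x).le

lemma hasDerivAt_stdNormalCdf (t : ℝ) : HasDerivAt stdNormalCdf (stdNormalPdf t) t := by
  have h : stdNormalCdf = fun x => stdNormalCdf 0 + ∫ y in (0 : ℝ)..x, stdNormalPdf y := by
    funext x
    rw [← intervalIntegral.integral_Iic_sub_Iic integrable_stdNormalPdf.integrableOn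
      integrable_stdNormalPdf.integrableOn, stdNormalCdf_eq_integral, stdNormalCdf_eq_integral]
    ring
  rw [h]
  exact (intervalIntegral.integral_hasDerivAt_right
    (continuous_stdNormalPdf.intervalIntegrable _ _)
    (continuous_stdNormalPdf.stronglyMeasurableAtFilter _ _)
    continuous_stdNormalPdf.continuousAt).const_add _

lemma continuous_stdNormalCdf : Continuous stdNormalCdf :=
  continuous_iff_continuousAt.2 fun t => (hasDerivAt_stdNormalCdf t).continuousAt

lemma strictMono_stdNormalCdf : StrictMono stdNormalCdf :=
  strictMono_of_hasDerivAt_pos hasDerivAt_stdNormalCdf stdNormalPdf_pos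

lemma tendsto_stdNormalCdf_atTop : Tendsto stdNormalCdf atTop (𝓝 1) :=
  ProbabilityTheory.tendsto_cdf_atTop _

lemma tendsto_stdNormalCdf_atBot : Tendsto stdNormalCdf atBot (𝓝 0) :=
  ProbabilityTheory.tendsto_cdf_atBot _

lemma stdNormalCdf_nonneg (t : ℝ) : 0 ≤ stdNormalCdf t := ProbabilityTheory.cdf_nonneg _ _

lemma stdNormalTail_pos (t : ℝ) : 0 < stdNormalTail t := by
  have h1 : stdNormalCdf t < stdNormalCdf (t + 1) := strictMono_stdNormalCdf (by linarith)
  have h2 : stdNormalCdf (t + 1) ≤ 1 := ProbabilityTheory.cdf_le_one _ _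
  unfold stdNormalTail
  linarith

lemma stdNormalTail_le_one (t : ℝ) : stdNormalTail t ≤ 1 := by
  have := stdNormalCdf_nonneg t
  unfold stdNormalTail
  linarith

lemma hasDerivAt_stdNormalTail (t : ℝ) : HasDerivAt stdNormalTail (-stdNormalPdf t) t :=
  (hasDerivAt_stdNormalCdf t).const_sub 1

lemma tendsto_stdNormalTail_atTop : Tendsto stdNormalTail atTop (𝓝 0) := by
  have h := tendsto_stdNormalCdf_atTop.const_sub 1
  rwa [sub_self] at h

lemma strictAnti_stdNormalTail : StrictAnti stdNormalTail := fun _ _ h =>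
  sub_lt_sub_left (strictMono_stdNormalCdf h) 1

lemma stdNormalCdf_zero : stdNormalCdf 0 = 1 / 2 := by
  have hconst : ∀ t, HasDerivAt (fun t => stdNormalCdf t + stdNormalCdf (-t)) 0 t := by
    intro t
    refine ((hasDerivAt_stdNormalCdf t).add
      ((hasDerivAt_stdNormalCdf (-t)).comp t (hasDerivAt_neg t))).congr_deriv ?_
    simp [stdNormalPdf]
  have heq : ∀ t, stdNormalCdf t + stdNormalCdf (-t) = stdNormalCdf 0 + stdNormalCdf (-0) :=
    fun t => is_const_of_deriv_eq_zero (fun t => (hconst t).differentiableAt)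
      (fun t => (hconst t).deriv) t 0
  have hlim : Tendsto (fun t => stdNormalCdf t + stdNormalCdf (-t)) atTop (𝓝 (1 + 0)) :=
    tendsto_stdNormalCdf_atTop.add (tendsto_stdNormalCdf_atBot.comp tendsto_neg_atTop_atBot)
  have h2 := tendsto_nhds_unique (hlim.congr heq) tendsto_const_nhds
  simp only [neg_zero] at h2
  linarith

/-! ### Upper and lower bounds for the normal tail. -/

lemma hasDerivAt_stdNormalPdf (t : ℝ) : HasDerivAt stdNormalPdf (-t * stdNormalPdf t) t := by
  have h1 : HasDerivAt (fun t : ℝ => -t ^ 2 / 2) (-t) t := by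
    refine (((hasDerivAt_pow 2 t).neg).div_const 2).congr_deriv ?_
    norm_num
    ring
  refine (h1.exp.const_mul (Real.sqrt (2 * Real.pi))⁻¹).congr_deriv ?_
  unfold stdNormalPdf
  ring

lemma tendsto_stdNormalPdf_atTop : Tendsto stdNormalPdf atTop (𝓝 0) := by
  have h1 : Tendsto (fun t : ℝ => -t ^ 2 / 2) atTop atBot := by
    have : Tendsto (fun t : ℝ => t ^ 2 / 2) atTop atTop :=
      (tendsto_pow_atTop two_ne_zero).atTop_div_const two_pos
    exact (tendsto_neg_atTop_atBot.comp this).congr fun t => (neg_div _ _).symm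
  have h2 := (Real.tendsto_exp_atBot.comp h1).const_mul (Real.sqrt (2 * Real.pi))⁻¹
  rwa [mul_zero] at h2

/-- Reduces each tail bound to the sign of a derivative, both sides vanishing at infinity. -/
lemma pos_of_hasDerivAt_neg_of_tendsto_zero {f f' : ℝ → ℝ} {c : ℝ}
    (hf : ∀ t, c < t → HasDerivAt f (f' t) t) (hf' : ∀ t, c < t → f' t < 0)
    (hlim : Tendsto f atTop (𝓝 0)) {t : ℝ} (ht : c < t) : 0 < f t := by
  have hanti : StrictAntiOn f (Set.Ioi c) := by
    refine strictAntiOn_of_deriv_neg (convex_Ioi c)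
      (fun x hx => (hf x hx).continuousAt.continuousWithinAt) fun x hx => ?_
    rw [interior_Ioi] at hx
    rw [(hf x hx).deriv]
    exact hf' x hx
  have ht1 : c < t + 1 := by linarith
  have h1 : f (t + 1) < f t := hanti ht ht1 (by linarith)
  have h2 : 0 ≤ f (t + 1) := by
    refine le_of_tendsto hlim ?_
    filter_upwards [eventually_ge_atTop (t + 1)] with x hx
    exact hanti.antitoneOn ht1 (ht1.trans_le hx) hx
  linarith

/-- Birnbaum's lower bound for the normal tail. -/
lemma birnbaum_lt_stdNormalTail (t : ℝ) :
    stdNormalPdf t * ((Real.sqrt (t ^ 2 + 4) - t) / 2) < stdNormalTail t := by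
  rw [← sub_pos]
  refine pos_of_hasDerivAt_neg_of_tendsto_zero (c := t - 1)
    (f := fun t => stdNormalTail t - stdNormalPdf t * ((Real.sqrt (t ^ 2 + 4) - t) / 2))
    (f' := fun t => -stdNormalPdf t - (-t * stdNormalPdf t * ((Real.sqrt (t ^ 2 + 4) - t) / 2)
      + stdNormalPdf t * ((t / Real.sqrt (t ^ 2 + 4) - 1) / 2)))
    (fun x _ => ?_) (fun x _ => ?_) ?_ (by linarith)
  · have hs : HasDerivAt (fun t : ℝ => Real.sqrt (t ^ 2 + 4)) (x / Real.sqrt (x ^ 2 + 4)) x := by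
      have h1 : HasDerivAt (fun t : ℝ => t ^ 2 + 4) (2 * x) x := by
        simpa using (hasDerivAt_pow 2 x).add_const 4
      convert h1.sqrt (by positivity) using 1
      field_simp
    exact (hasDerivAt_stdNormalTail x).sub ((hasDerivAt_stdNormalPdf x).mul
      ((hs.sub (hasDerivAt_id x)).div_const 2))
  · have hφ := stdNormalPdf_pos x
    set w := Real.sqrt (x ^ 2 + 4) with hw
    have hw2 : w ^ 2 = x ^ 2 + 4 := Real.sq_sqrt (by positivity)
    have hw0 : 0 < w := Real.sqrt_pos.2 (by positivity)
    have hxw : x < w := by nlinarith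
    -- The squares of the two sides differ by exactly 4.
    have key : x * w < x ^ 2 + 2 := by
      by_contra! h
      nlinarith [mul_self_le_mul_self (by positivity : (0:ℝ) ≤ x ^ 2 + 2) h]
    have e : -stdNormalPdf x - (-x * stdNormalPdf x * ((w - x) / 2)
        + stdNormalPdf x * ((x / w - 1) / 2))
        = -(stdNormalPdf x * ((w - x) * (x ^ 2 + 2 - x * w) / (4 * w))) := by
      field_simp
      linear_combination 2 * x * hw2
    rw [e, neg_lt_zero]
    have : 0 < w - x := by linarith
    have : 0 < x ^ 2 + 2 - x * w := by linarith
    positivity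
  · have h0 : Tendsto (fun t => stdNormalPdf t * ((Real.sqrt (t ^ 2 + 4) - t) / 2)) atTop
        (𝓝 0) := by
      refine squeeze_zero' ?_ ?_ tendsto_stdNormalPdf_atTop
      · filter_upwards with t
        have h1 : t ≤ Real.sqrt (t ^ 2 + 4) := Real.le_sqrt_of_sq_le (by linarith)
        have := stdNormalPdf_pos t
        have : 0 ≤ (Real.sqrt (t ^ 2 + 4) - t) / 2 := by linarith
        positivity
      · filter_upwards [eventually_ge_atTop 0] with t ht
        have h1 : Real.sqrt (t ^ 2 + 4) ≤ t + 2 :=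
          Real.sqrt_le_iff.2 ⟨by linarith, by nlinarith⟩
        exact mul_le_of_le_one_right (stdNormalPdf_pos t).le (by linarith)
    simpa using tendsto_stdNormalTail_atTop.sub h0

/-- The rational factor is the convergent `1/(t + 1/(t + 2/t))` of Laplace's continued fraction. -/
lemma stdNormalTail_lt_of_pos {t : ℝ} (ht : 0 < t) :
    stdNormalTail t < stdNormalPdf t * ((t ^ 2 + 2) / (t ^ 3 + 3 * t)) := by
  rw [← sub_pos]
  refine pos_of_hasDerivAt_neg_of_tendsto_zero (c := 0)
    (f := fun t => stdNormalPdf t * ((t ^ 2 + 2) / (t ^ 3 + 3 * t)) - stdNormalTail t)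
    (f' := fun t => -t * stdNormalPdf t * ((t ^ 2 + 2) / (t ^ 3 + 3 * t))
      + stdNormalPdf t * ((2 * t * (t ^ 3 + 3 * t) - (t ^ 2 + 2) * (3 * t ^ 2 + 3))
        / (t ^ 3 + 3 * t) ^ 2) - -stdNormalPdf t)
    (fun x hx => ?_) (fun x hx => ?_) ?_ ht
  · have h1 : HasDerivAt (fun t : ℝ => t ^ 2 + 2) (2 * x) x := by
      simpa using (hasDerivAt_pow 2 x).add_const 2
    have h2 : HasDerivAt (fun t : ℝ => t ^ 3 + 3 * t) (3 * x ^ 2 + 3) x := by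
      refine ((hasDerivAt_pow 3 x).add ((hasDerivAt_id x).const_mul 3)).congr_deriv ?_
      norm_num
    exact ((hasDerivAt_stdNormalPdf x).mul (h1.div h2 (by positivity))).sub
      (hasDerivAt_stdNormalTail x)
  · have hφ := stdNormalPdf_pos x
    have e : -x * stdNormalPdf x * ((x ^ 2 + 2) / (x ^ 3 + 3 * x))
      + stdNormalPdf x * ((2 * x * (x ^ 3 + 3 * x) - (x ^ 2 + 2) * (3 * x ^ 2 + 3))
        / (x ^ 3 + 3 * x) ^ 2) - -stdNormalPdf x
      = -(stdNormalPdf x * (6 / (x ^ 3 + 3 * x) ^ 2)) := by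
      have : x ^ 3 + 3 * x ≠ 0 := by positivity
      field_simp
      ring
    rw [e, neg_lt_zero]
    positivity
  · have h0 : Tendsto (fun t => stdNormalPdf t * ((t ^ 2 + 2) / (t ^ 3 + 3 * t))) atTop
        (𝓝 0) := by
      refine squeeze_zero' ?_ ?_ tendsto_stdNormalPdf_atTop
      · filter_upwards [eventually_ge_atTop 0] with t ht
        have := stdNormalPdf_pos t
        positivity
      · filter_upwards [eventually_ge_atTop 1] with t ht
        refine mul_le_of_le_one_right (stdNormalPdf_pos t).le ?_
        rw [div_le_one (by positivity)]
        nlinarith [mul_nonneg (sq_nonneg t) (sub_nonneg.2 ht)]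
    simpa using h0.sub tendsto_stdNormalTail_atTop

/-! ### Hazard rate and cumulative hazard. -/

lemma hazard_pos (t : ℝ) : 0 < hazard t := div_pos (stdNormalPdf_pos t) (stdNormalTail_pos t)

lemma lt_hazard_mul {t : ℝ} (ht : 0 < t) :
    t * (t ^ 2 + 3) / (t ^ 2 + 2) < hazard t := by
  have h := stdNormalTail_lt_of_pos ht
  rw [hazard, lt_div_iff₀ (stdNormalTail_pos t)]
  calc t * (t ^ 2 + 3) / (t ^ 2 + 2) * stdNormalTail t
      < t * (t ^ 2 + 3) / (t ^ 2 + 2) * (stdNormalPdf t * ((t ^ 2 + 2) / (t ^ 3 + 3 * t))) := by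
        gcongr
    _ = stdNormalPdf t := by field_simp

lemma lt_hazard (t : ℝ) : t < hazard t := by
  rcases le_or_gt t 0 with ht | ht
  · exact ht.trans_lt (hazard_pos t)
  · refine lt_of_le_of_lt ?_ (lt_hazard_mul ht)
    rw [le_div_iff₀ (by positivity)]
    nlinarith

/-- Birnbaum's bound puts `hazard t` below `(t + √(t² + 4)) / 2`, the positive root of `r (r - t) =
1`. The left side is the derivative of `hazard`. -/
lemma hazard_mul_sub_lt_one (t : ℝ) : hazard t * (hazard t - t) < 1 := by
  have h := birnbaum_lt_stdNormalTail t
  set w := Real.sqrt (t ^ 2 + 4) with hw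
  have hw2 : w ^ 2 = t ^ 2 + 4 := Real.sq_sqrt (by positivity)
  have hw0 : 0 < w := Real.sqrt_pos.2 (by positivity)
  have htw : t < w := by nlinarith
  have h1 : hazard t < (w + t) / 2 := by
    rw [hazard, div_lt_iff₀ (stdNormalTail_pos t)]
    have h2 : 0 < w + t := by nlinarith
    have h5 : (w + t) * (stdNormalPdf t * ((w - t) / 2)) = 2 * stdNormalPdf t := by
      linear_combination stdNormalPdf t / 2 * hw2
    linarith [mul_lt_mul_of_pos_left h h2]
  have h3 := lt_hazard t
  have h4 := hazard_pos t
  nlinarith [mul_pos (sub_pos.2 h1) (sub_pos.2 h3)]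

lemma hazard_mul_lt (t : ℝ) : hazard t * t < t ^ 2 + 1 := by
  nlinarith [hazard_mul_sub_lt_one t, sq_nonneg (hazard t - t)]

lemma hasDerivAt_hazard (t : ℝ) : HasDerivAt hazard (hazard t * (hazard t - t)) t := by
  have h0 := (stdNormalTail_pos t).ne'
  refine ((hasDerivAt_stdNormalPdf t).div (hasDerivAt_stdNormalTail t) h0).congr_deriv ?_
  unfold hazard
  field_simp
  ring

lemma hasDerivAt_cumHazard (t : ℝ) : HasDerivAt cumHazard (hazard t) t := by
  refine ((hasDerivAt_stdNormalTail t).log (stdNormalTail_pos t).ne').neg.congr_deriv ?_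
  unfold hazard
  ring

lemma monotone_hazard : Monotone hazard :=
  monotone_of_hasDerivAt_nonneg hasDerivAt_hazard fun t =>
    mul_nonneg (hazard_pos t).le (sub_nonneg.2 (lt_hazard t).le)

lemma monotone_sub_hazard : Monotone fun t => t - hazard t :=
  monotone_of_hasDerivAt_nonneg (fun t => (hasDerivAt_id t).sub (hasDerivAt_hazard t)) fun t =>
    sub_nonneg.2 (hazard_mul_sub_lt_one t).le

lemma tangent_le_of_monotone_deriv {f f' : ℝ → ℝ} (hf : ∀ t, HasDerivAt f (f' t) t)
    (hf' : Monotone f') (s t : ℝ) : f' s * (t - s) ≤ f t - f s := by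
  rcases lt_trichotomy s t with h | rfl | h
  · obtain ⟨c, hc, e⟩ := exists_hasDerivAt_eq_slope f f' h
      (fun x _ => (hf x).continuousAt.continuousWithinAt) fun x _ => hf x
    rw [eq_div_iff (by linarith)] at e
    nlinarith [hf' hc.1.le]
  · simp
  · obtain ⟨c, hc, e⟩ := exists_hasDerivAt_eq_slope f f' h
      (fun x _ => (hf x).continuousAt.continuousWithinAt) fun x _ => hf x
    rw [eq_div_iff (by linarith)] at e
    nlinarith [hf' hc.2.le]

lemma le_cumHazard_sub (s t : ℝ) : hazard s * (t - s) ≤ cumHazard t - cumHazard s :=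
  tangent_le_of_monotone_deriv hasDerivAt_cumHazard monotone_hazard s t

/-- Tangent inequality for `t² / 2 - H`, convex because `h' ≤ 1`. -/
lemma cumHazard_sub_le (s t : ℝ) :
    cumHazard t - cumHazard s ≤ hazard s * (t - s) + (t - s) ^ 2 / 2 := by
  have h1 : ∀ t, HasDerivAt (fun t => t ^ 2 / 2 - cumHazard t) (t - hazard t) t := by
    intro t
    refine HasDerivAt.sub ?_ (hasDerivAt_cumHazard t)
    simpa using (hasDerivAt_pow 2 t).div_const 2
  have h2 := tangent_le_of_monotone_deriv h1 monotone_sub_hazard s t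
  nlinarith

lemma exp_neg_cumHazard (t : ℝ) : Real.exp (-cumHazard t) = stdNormalTail t := by
  rw [cumHazard, neg_neg, Real.exp_log (stdNormalTail_pos t)]

/-! ### Elementary estimates for exponentials. -/

lemma mul_exp_neg_mul_le {c : ℝ} (hc : 0 < c) (x : ℝ) :
    x * Real.exp (-(c * x)) ≤ Real.exp (-1) / c := by
  have h1 := Real.add_one_le_exp (c * x - 1)
  have h2 : Real.exp (-1) = Real.exp (c * x - 1) * Real.exp (-(c * x)) := by
    rw [← Real.exp_add]; ring_nf
  rw [le_div_iff₀ hc, h2]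
  nlinarith [Real.exp_pos (-(c * x))]

lemma sq_mul_exp_neg_mul_le {c : ℝ} (hc : 0 < c) {x : ℝ} (hx : 0 ≤ x) :
    x ^ 2 * Real.exp (-(c * x)) ≤ 4 * Real.exp (-2) / c ^ 2 := by
  have h1 := mul_exp_neg_mul_le (half_pos hc) x
  have h2 := pow_le_pow_left₀ (by positivity) h1 2
  have h3 : Real.exp (-(c * x)) = Real.exp (-(c / 2 * x)) ^ 2 := by
    rw [← Real.exp_nat_mul]; push_cast; ring_nf
  have h4 : Real.exp (-2) = Real.exp (-1) ^ 2 := by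
    rw [← Real.exp_nat_mul]; norm_num
  calc x ^ 2 * Real.exp (-(c * x)) = (x * Real.exp (-(c / 2 * x))) ^ 2 := by rw [h3]; ring
    _ ≤ (Real.exp (-1) / (c / 2)) ^ 2 := h2
    _ = _ := by rw [h4]; field_simp; norm_num

lemma exp_neg_one_lt : Real.exp (-1) < 0.36788 := by
  rw [Real.exp_neg, inv_lt_comm₀ (Real.exp_pos _) (by norm_num)]
  exact lt_trans (by norm_num) Real.exp_one_gt_d9

lemma exp_neg_two_lt : Real.exp (-2) < 0.13534 := by
  have h : Real.exp (-2) = Real.exp (-1) ^ 2 := by rw [← Real.exp_nat_mul]; norm_num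
  rw [h]
  calc Real.exp (-1) ^ 2 < 0.36788 ^ 2 := by gcongr; exact exp_neg_one_lt
    _ < _ := by norm_num

lemma exp_neg_sub_exp_neg_le {p q B : ℝ} (hp : 0 ≤ p) (hB : 0 ≤ B) (h : q - p ≤ B) :
    Real.exp (-p) - Real.exp (-q) ≤ B := by
  rcases le_total q p with hqp | hqp
  · have := Real.exp_le_exp.2 (neg_le_neg hqp)
    linarith
  · have h1 : Real.exp (-q) = Real.exp (-p) * Real.exp (-(q - p)) := by
      rw [← Real.exp_add]; ring_nf
    have h2 : Real.exp (-p) ≤ 1 := Real.exp_le_one_iff.2 (by linarith)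
    have h3 := Real.one_sub_le_exp_neg (q - p)
    rw [h1]
    nlinarith [Real.exp_pos (-p)]

/-- From `e^{-q} (1 - q²) ≤ 1 - q ≤ e^{-q}` and Bernoulli, the gap is at most `(n q)² e^{-n q} / n`;
and `u² e^{-u}` peaks at `u = 2`. -/
lemma abs_one_sub_pow_sub_exp_le {q : ℝ} (h0 : 0 ≤ q) (h1 : q ≤ 1) {n : ℕ} (hn : 0 < n) :
    |(1 - q) ^ n - Real.exp (-(n * q))| ≤ 4 * Real.exp (-2) / n := by
  have hn' : (0 : ℝ) < n := by exact_mod_cast hn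
  have he : Real.exp (-(n * q)) = Real.exp (-q) ^ n := by rw [← Real.exp_nat_mul]; ring_nf
  have hup : (1 - q) ^ n ≤ Real.exp (-(n * q)) := by
    rw [he]
    exact pow_le_pow_left₀ (by linarith) (Real.one_sub_le_exp_neg q) n
  have h2 : Real.exp (-q) * (1 - q ^ 2) ≤ 1 - q := by
    have h3 : Real.exp (-q) * (1 + q) ≤ 1 := by
      rw [Real.exp_neg, inv_mul_le_one₀ (Real.exp_pos q)]
      linarith [Real.add_one_le_exp q]
    nlinarith
  have h4 : Real.exp (-(n * q)) * (1 - n * q ^ 2) ≤ (1 - q) ^ n := by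
    calc Real.exp (-(n * q)) * (1 - n * q ^ 2)
        ≤ Real.exp (-q) ^ n * (1 - q ^ 2) ^ n := by
          rw [he]
          gcongr
          have := one_add_mul_le_pow (a := -q ^ 2) (by nlinarith) n
          calc 1 - n * q ^ 2 = 1 + n * (-q ^ 2) := by ring
            _ ≤ (1 + -q ^ 2) ^ n := this
            _ = _ := by ring
      _ = (Real.exp (-q) * (1 - q ^ 2)) ^ n := (mul_pow _ _ _).symm
      _ ≤ _ := by
          gcongr
          exact mul_nonneg (Real.exp_pos _).le (by nlinarith)
  have h5 := sq_mul_exp_neg_mul_le one_pos (mul_nonneg hn'.le h0)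
  simp only [one_mul, one_pow, div_one] at h5
  rw [abs_sub_comm, abs_of_nonneg (sub_nonneg.2 hup), le_div_iff₀ hn']
  nlinarith

/-- The outer exponential is 1-Lipschitz here, so `e^{-D}` is compared with `e^{-x}`: `B` must
dominate the maxima of `κ x² e^{-x} / 2` and `(1 - η) x e^{-η x}`. -/
lemma abs_exp_neg_exp_neg_sub_gumbelCdf_le_of_nonneg {η κ D x B : ℝ} (hη : 0 < η)
    (hη1 : η ≤ 1) (hκ : 0 ≤ κ) (hx : 0 ≤ x) (hl : η * x ≤ D) (hu : D ≤ η * x + κ * x ^ 2 / 2)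
    (hB1 : 2 * Real.exp (-2) * κ ≤ B) (hB2 : Real.exp (-1) * ((1 - η) / η) ≤ B) :
    |Real.exp (-Real.exp (-D)) - gumbelCdf x| ≤ B := by
  have hB : 0 ≤ B := le_trans (by positivity) hB1
  unfold gumbelCdf
  rw [abs_le]
  constructor
  · rw [neg_le_sub_iff_le_add, ← sub_le_iff_le_add']
    refine exp_neg_sub_exp_neg_le (Real.exp_pos _).le hB (le_trans ?_ hB2)
    have h1 : Real.exp (-D) ≤ Real.exp (-(η * x)) := Real.exp_le_exp.2 (by linarith)
    have h2 : Real.exp (-x) = Real.exp (-(η * x)) * Real.exp (-((1 - η) * x)) := by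
      rw [← Real.exp_add]; ring_nf
    have h3 := Real.one_sub_le_exp_neg ((1 - η) * x)
    have h4 := mul_exp_neg_mul_le hη x
    calc Real.exp (-D) - Real.exp (-x)
        ≤ Real.exp (-(η * x)) * ((1 - η) * x) := by
          rw [h2]; nlinarith [Real.exp_pos (-(η * x))]
      _ = (1 - η) * (x * Real.exp (-(η * x))) := by ring
      _ ≤ (1 - η) * (Real.exp (-1) / η) := by gcongr
      _ = _ := by ring
  · refine exp_neg_sub_exp_neg_le (Real.exp_pos _).le hB (le_trans ?_ hB1)
    have h1 : D ≤ x + κ * x ^ 2 / 2 := by nlinarith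
    have h2 : Real.exp (-x) * Real.exp (-(κ * x ^ 2 / 2)) ≤ Real.exp (-D) := by
      rw [← Real.exp_add]
      exact Real.exp_le_exp.2 (by linarith)
    have h3 := Real.one_sub_le_exp_neg (κ * x ^ 2 / 2)
    have h4 := sq_mul_exp_neg_mul_le one_pos hx
    simp only [one_mul, one_pow, div_one] at h4
    nlinarith [Real.exp_pos (-x)]

lemma gumbelCdf_le_exp_neg_exp {η D y : ℝ} (hη1 : η ≤ 1) (hy : 0 ≤ y) (hl : -(η * y) ≤ D) :
    gumbelCdf (-y) ≤ Real.exp (-Real.exp (-D)) := by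
  unfold gumbelCdf
  rw [neg_neg, Real.exp_le_exp, neg_le_neg_iff, Real.exp_le_exp]
  nlinarith

/-- With `R = e^{-D} ≥ e^{0.67 y} ≥ 0.67 e y ≥ 1.82 y`, the factor `e^{-R}` absorbs the `e^y` from
the mean value estimate and leaves `e^{-0.82 y}`. -/
lemma exp_neg_exp_sub_gumbelCdf_le_mul {δ D y : ℝ} (hu : D ≤ -y + δ)
    (hδ0 : 0 ≤ δ) (hδ : δ ≤ 0.33 * y) :
    Real.exp (-Real.exp (-D)) - gumbelCdf (-y) ≤ δ * Real.exp (-(0.82 * y)) := by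
  have hy : 0 ≤ y := by linarith
  unfold gumbelCdf
  rw [neg_neg]
  set R := Real.exp (-D) with hR
  have h1 : Real.exp (-Real.exp y) = Real.exp (-R) * Real.exp (-(Real.exp y - R)) := by
    rw [← Real.exp_add]; ring_nf
  have h2 := Real.one_sub_le_exp_neg (Real.exp y - R)
  have h3 : Real.exp (-R) - Real.exp (-Real.exp y) ≤ Real.exp (-R) * (Real.exp y - R) := by
    rw [h1]; nlinarith [Real.exp_pos (-R)]
  have h4 : Real.exp y * Real.exp (-δ) ≤ R := by
    rw [← Real.exp_add]
    exact Real.exp_le_exp.2 (by linarith)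
  have h5 : Real.exp y - R ≤ Real.exp y * δ := by
    nlinarith [Real.one_sub_le_exp_neg δ, Real.exp_pos y]
  have h6 : Real.exp 1 * (0.67 * y) ≤ R := by
    calc Real.exp 1 * (0.67 * y) ≤ Real.exp 1 * Real.exp (0.67 * y - 1) := by
          gcongr; linarith [Real.add_one_le_exp (0.67 * y - 1)]
      _ = Real.exp (0.67 * y) := by rw [← Real.exp_add]; ring_nf
      _ ≤ R := Real.exp_le_exp.2 (by linarith)
  have h7 : 1.82 * y ≤ R := by nlinarith [Real.exp_one_gt_d9]
  calc Real.exp (-R) - Real.exp (-Real.exp y) ≤ Real.exp (-R) * (Real.exp y - R) := h3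
    _ ≤ Real.exp (-R) * (Real.exp y * δ) := by gcongr
    _ ≤ Real.exp (-(1.82 * y)) * (Real.exp y * δ) := by gcongr
    _ = δ * Real.exp (-(0.82 * y)) := by
      rw [← mul_assoc, ← Real.exp_add, mul_comm]; ring_nf

/-! ### Comparison of `tailDecrement` with the identity. -/

/-- The logarithmic decrement `log (1 - Φ(b)) - log (1 - Φ(a x + b))` with `a = b / (1 + b²)`. -/
def tailDecrement (b x : ℝ) : ℝ := cumHazard (b / (1 + b ^ 2) * x + b) - cumHazard b

/-- The slope of `tailDecrement b` at the origin. -/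
def tailSlope (b : ℝ) : ℝ := hazard b * (b / (1 + b ^ 2))

lemma tailSlope_mul_le (b x : ℝ) : tailSlope b * x ≤ tailDecrement b x := by
  have := le_cumHazard_sub b (b / (1 + b ^ 2) * x + b)
  unfold tailSlope tailDecrement
  linarith

lemma tailDecrement_le (b x : ℝ) :
    tailDecrement b x ≤ tailSlope b * x + (b / (1 + b ^ 2)) ^ 2 * x ^ 2 / 2 := by
  have := cumHazard_sub_le b (b / (1 + b ^ 2) * x + b)
  unfold tailSlope tailDecrement
  linarith

lemma tailSlope_le_one (b : ℝ) : tailSlope b ≤ 1 := by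
  have := hazard_mul_lt b
  unfold tailSlope
  rw [← mul_div_assoc, div_le_one (by positivity)]
  linarith

lemma le_tailSlope {b s : ℝ} (hb : 0 < b) (hs : 0 ≤ s) (h : s ≤ b ^ 2) :
    s * (s + 3) / ((s + 1) * (s + 2)) ≤ tailSlope b := by
  have h1 := lt_hazard_mul hb
  calc s * (s + 3) / ((s + 1) * (s + 2))
      ≤ b ^ 2 * (b ^ 2 + 3) / ((b ^ 2 + 1) * (b ^ 2 + 2)) := by
        rw [div_le_div_iff₀ (by positivity) (by positivity)]
        nlinarith [mul_nonneg (sub_nonneg.2 h) (by positivity : 0 ≤ s + b ^ 2 + 3)]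
    _ = b * (b ^ 2 + 3) / (b ^ 2 + 2) * (b / (1 + b ^ 2)) := by field_simp; ring
    _ ≤ _ := by unfold tailSlope; gcongr

lemma scale_sq_le (b : ℝ) : (b / (1 + b ^ 2)) ^ 2 ≤ 1 / 4 := by
  rw [div_pow, div_le_div_iff₀ (by positivity) (by norm_num)]
  nlinarith [sq_nonneg (b ^ 2 - 1)]

lemma scale_sq_mul_sq_le (b : ℝ) : b ^ 2 * (b / (1 + b ^ 2)) ^ 2 ≤ 1 := by
  rw [div_pow, ← mul_div_assoc, div_le_one (by positivity)]
  nlinarith [sq_nonneg b]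

/-- `b³ / (1 + b²)²` peaks at `b = √3`, with value `3√3 / 16 ≈ 0.325`. -/
lemma scale_sq_mul_le (b : ℝ) : (b / (1 + b ^ 2)) ^ 2 * b ≤ 0.33 := by
  rw [div_pow, div_mul_eq_mul_div, div_le_iff₀ (by positivity)]
  nlinarith [sq_nonneg (b ^ 2 - 1.7 * b),
    sq_nonneg (b ^ 2 - 3), sq_nonneg (b - 1.73)]

lemma monotone_cumHazard : Monotone cumHazard :=
  monotone_of_hasDerivAt_nonneg hasDerivAt_cumHazard fun t => (hazard_pos t).le

lemma monotone_tailDecrement {b : ℝ} (hb : 0 ≤ b) : Monotone (tailDecrement b) := by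
  intro x y h
  refine sub_le_sub_right (monotone_cumHazard ?_) _
  gcongr

/-- Gumbel approximation error of the Poissonized maximum, for moderately large `b`. -/
lemma abs_exp_neg_exp_tailDecrement_sub_gumbelCdf_le {b : ℝ} (hb : 1.44 ≤ b) (x : ℝ) :
    |Real.exp (-Real.exp (-tailDecrement b x)) - gumbelCdf x| ≤ 0.6 / b ^ 2 := by
  have hb0 : 0 < b := by linarith
  have hs : 2.07 ≤ b ^ 2 := by nlinarith
  set s := b ^ 2 with hsdef
  have hs0 : 0 < s := by linarith
  set κ := (b / (1 + s)) ^ 2 with hκ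
  have hκ0 : 0 ≤ κ := by positivity
  have hκ1 : s * κ ≤ 1 := scale_sq_mul_sq_le b
  have hη1 := tailSlope_le_one b
  have hηl := le_tailSlope hb0 hs0.le hsdef.le
  set η := tailSlope b with hη
  have hη0 : 0 < η := lt_of_lt_of_le (by positivity) hηl
  have hε : 1 - η ≤ 2 / ((s + 1) * (s + 2)) := by
    have : s * (s + 3) / ((s + 1) * (s + 2)) = 1 - 2 / ((s + 1) * (s + 2)) := by
      field_simp; ring
    linarith
  have hl := tailSlope_mul_le b
  have hu := tailDecrement_le b
  rcases le_total 0 x with hx | hx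
  · refine abs_exp_neg_exp_neg_sub_gumbelCdf_le_of_nonneg hη0 hη1 hκ0 hx (hl x) (hu x) ?_ ?_
    · rw [le_div_iff₀ hs0]
      nlinarith [exp_neg_two_lt, Real.exp_pos (-2)]
    · have h1 : (1 - η) / η ≤ 2 / (s * (s + 3)) := by
        calc (1 - η) / η ≤ (2 / ((s + 1) * (s + 2))) / (s * (s + 3) / ((s + 1) * (s + 2))) := by
              gcongr
          _ = _ := by field_simp
      calc Real.exp (-1) * ((1 - η) / η) ≤ 0.36788 * (2 / (s * (s + 3))) :=
            mul_le_mul exp_neg_one_lt.le h1 (div_nonneg (by linarith) hη0.le) (by norm_num)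
        _ ≤ _ := by
          rw [← mul_div_assoc, div_le_div_iff₀ (by positivity) hs0]
          nlinarith
  · obtain ⟨y, rfl⟩ : ∃ y, x = -y := ⟨-x, by ring⟩
    have hy : 0 ≤ y := by linarith
    -- `2 s / ((s + 1)(s + 2))` peaks at `s = √2`, with value about 0.343.
    have hsε : s * (1 - η) ≤ 0.345 := by
      calc s * (1 - η) ≤ s * (2 / ((s + 1) * (s + 2))) := by gcongr
        _ ≤ 0.345 := by
          rw [← mul_div_assoc, div_le_iff₀ (by positivity)]
          nlinarith [sq_nonneg (s - 1.41)]
    have hε2 : 1 - η ≤ 0.165 := by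
      refine hε.trans ?_
      rw [div_le_iff₀ (by positivity)]
      nlinarith
    have hκb : κ * b ≤ 0.33 := scale_sq_mul_le b
    have hnn : gumbelCdf (-y) ≤ Real.exp (-Real.exp (-tailDecrement b (-y))) :=
      gumbelCdf_le_exp_neg_exp hη1 hy (by linarith [hl (-y)])
    rw [abs_of_nonneg (sub_nonneg.2 hnn), le_div_iff₀ hs0]
    -- `0.33 = 0.165 + 0.33 / 2`; the quadratic term is under control only up to `b`.
    have hδ : ∀ z, 0 ≤ z → z ≤ b → (1 - η) * z + κ * z ^ 2 / 2 ≤ 0.33 * z := by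
      intro z hz hzb
      have h1 : κ * z ≤ κ * b := by gcongr
      nlinarith
    rcases le_total y b with hyb | hyb
    · have h1 := exp_neg_exp_sub_gumbelCdf_le_mul (y := y) (D := tailDecrement b (-y))
        (δ := (1 - η) * y + κ * y ^ 2 / 2) (by linarith [hu (-y)])
        (by have := sub_nonneg.2 hη1; positivity) (hδ y hy hyb)
      have h2 := mul_exp_neg_mul_le (c := 0.82) (by norm_num) y
      have h3 := sq_mul_exp_neg_mul_le (c := 0.82) (by norm_num) hy
      have e1 := exp_neg_one_lt
      have e2 := exp_neg_two_lt
      set E := Real.exp (-(0.82 * y))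
      have hE : 0 < E := Real.exp_pos _
      calc _ ≤ ((1 - η) * y + κ * y ^ 2 / 2) * E * s := by gcongr
        _ = (s * (1 - η)) * (y * E) + (s * κ) * (y ^ 2 * E) / 2 := by ring
        _ ≤ 0.345 * (y * E) + 1 * (y ^ 2 * E) / 2 := by gcongr
        _ ≤ 0.345 * (Real.exp (-1) / 0.82) + 1 * (4 * Real.exp (-2) / 0.82 ^ 2) / 2 := by gcongr
        _ ≤ 0.6 := by norm_num at *; linarith
    -- Beyond `b`, monotonicity replaces the quadratic bound: `e^{-D} ≥ e^{0.67 b} ≥ b`, and `b²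
    -- e^{-b} ≤ 4 e⁻² < 0.6`.
    · have hδb := hδ b hb0.le le_rfl
      have h1 : Real.exp (0.67 * b) ≤ Real.exp (-tailDecrement b (-y)) := by
        refine Real.exp_le_exp.2 ?_
        have := monotone_tailDecrement hb0.le (neg_le_neg hyb)
        linarith [hu (-b)]
      have h2 : Real.exp 1 * (0.67 * b) ≤ Real.exp (0.67 * b) := by
        calc Real.exp 1 * (0.67 * b) ≤ Real.exp 1 * Real.exp (0.67 * b - 1) := by
              gcongr; linarith [Real.add_one_le_exp (0.67 * b - 1)]
          _ = Real.exp (0.67 * b) := by rw [← Real.exp_add]; ring_nf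
      have h3 : 1 * b ≤ Real.exp (-tailDecrement b (-y)) := by
        nlinarith [Real.exp_one_gt_d9]
      have h4 : Real.exp (-Real.exp (-tailDecrement b (-y))) ≤ Real.exp (-(1 * b)) :=
        Real.exp_le_exp.2 (neg_le_neg h3)
      have h5 := sq_mul_exp_neg_mul_le one_pos hb0.le
      have h6 : 0 < gumbelCdf (-y) := Real.exp_pos _
      have e2 := exp_neg_two_lt
      rw [one_pow, div_one, ← hsdef] at h5
      calc _ ≤ Real.exp (-(1 * b)) * s := by gcongr; linarith
        _ = s * Real.exp (-(1 * b)) := mul_comm _ _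
        _ ≤ 0.6 := by linarith

lemma exp_neg_exp_one_gt : 0.063 < Real.exp (-Real.exp 1) := by
  have h1 : Real.exp 1 ≤ 68 / 25 := Real.exp_one_lt_d9.le.trans (by norm_num)
  have h2 : Real.exp (68 / 25) < 15.87 := by
    -- Raising to the 25th power turns `e^{68/25}` into an integer power of `e`.
    refine lt_of_pow_lt_pow_left₀ 25 (by norm_num) ?_
    rw [← Real.exp_nat_mul]
    calc Real.exp ((25 : ℕ) * (68 / 25)) = Real.exp 1 ^ 68 := by
          rw [← Real.exp_nat_mul]; norm_num
      _ ≤ 2.7182818286 ^ 68 := by gcongr; exact Real.exp_one_lt_d9.le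
      _ < 15.87 ^ 25 := by norm_num
  rw [Real.exp_neg, lt_inv_comm₀ (by norm_num) (Real.exp_pos _)]
  calc _ ≤ Real.exp (68 / 25) := Real.exp_le_exp.2 h1
    _ < 15.87 := h2
    _ < _ := by norm_num

/-- Gumbel approximation error of the Poissonized maximum, for small `b`. -/
lemma abs_exp_neg_exp_tailDecrement_sub_gumbelCdf_le_of_small {b : ℝ} (hb : 0.82 ≤ b) (x : ℝ) :
    |Real.exp (-Real.exp (-tailDecrement b x)) - gumbelCdf x| ≤ 0.305 := by
  have hb0 : 0 < b := by linarith
  have hκ := scale_sq_le b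
  have hκ0 : 0 ≤ (b / (1 + b ^ 2)) ^ 2 := by positivity
  have hη1 := tailSlope_le_one b
  -- `0.6724 = 0.82²`.
  have hηl := le_tailSlope hb0 (s := 0.6724) (by norm_num) (by nlinarith)
  have hη : 0.5525 ≤ tailSlope b := le_trans (by norm_num) hηl
  have hη0 : 0 < tailSlope b := by linarith
  have hl := tailSlope_mul_le b
  have hu := tailDecrement_le b
  rcases le_total 0 x with hx | hx
  · refine abs_exp_neg_exp_neg_sub_gumbelCdf_le_of_nonneg hη0 hη1 hκ0 hx (hl x) (hu x) ?_ ?_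
    · nlinarith [exp_neg_two_lt, Real.exp_pos (-2)]
    · have h1 : (1 - tailSlope b) / tailSlope b ≤ 0.811 := by
        rw [div_le_iff₀ hη0]
        linarith
      nlinarith [exp_neg_one_lt, Real.exp_pos (-1)]
  · obtain ⟨y, rfl⟩ : ∃ y, x = -y := ⟨-x, by ring⟩
    have hy : 0 ≤ y := by linarith
    have hnn : gumbelCdf (-y) ≤ Real.exp (-Real.exp (-tailDecrement b (-y))) :=
      gumbelCdf_le_exp_neg_exp hη1 hy (by linarith [hl (-y)])
    rw [abs_of_nonneg (sub_nonneg.2 hnn)]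
    have hmono := monotone_tailDecrement hb0.le
    -- For `y ≤ 1` both values lie in `[e^{-e}, e^{-1}]`, whose length dictates 0.305. For `y ≥ 1`,
    -- `-D(-y) ≥ -D(-1) ≥ 0.5525 - 1/8 = 0.4275`.
    rcases le_total y 1 with hy1 | hy1
    · have h1 : tailDecrement b (-y) ≤ 0 := by
        have h2 := hmono (by linarith : -y ≤ 0)
        have h3 : tailDecrement b 0 = 0 := by simp [tailDecrement]
        linarith
      have h4 : Real.exp (-Real.exp (-tailDecrement b (-y))) ≤ Real.exp (-1) :=
        Real.exp_le_exp.2 (neg_le_neg (Real.one_le_exp (by linarith)))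
      have h5 : Real.exp (-Real.exp 1) ≤ gumbelCdf (-y) := by
        unfold gumbelCdf
        rw [neg_neg]
        gcongr
      linarith [exp_neg_one_lt, exp_neg_exp_one_gt]
    · have h1 : 1.4275 ≤ Real.exp (-tailDecrement b (-y)) := by
        refine le_trans ?_ (Real.add_one_le_exp _)
        linarith [hmono (neg_le_neg hy1), hu (-1)]
      have h2 : Real.exp (-Real.exp (-tailDecrement b (-y))) ≤ Real.exp (-1) * Real.exp (-0.4275) := by
        rw [← Real.exp_add]
        exact Real.exp_le_exp.2 (by linarith)
      have h3 : Real.exp (-0.4275) ≤ 0.71 := by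
        rw [Real.exp_neg, inv_le_comm₀ (Real.exp_pos _) (by norm_num)]
        exact le_trans (by norm_num) (Real.add_one_le_exp _)
      have h6 : 0 < gumbelCdf (-y) := Real.exp_pos _
      nlinarith [exp_neg_one_lt, Real.exp_pos (-1)]

/-! ### The quantiles `b_n` and their numerical lower bounds. -/

lemma stdNormalCdf_stdNormalCdfInv {p : ℝ} (h0 : 0 < p) (h1 : p < 1) :
    stdNormalCdf (stdNormalCdfInv p) = p := by
  obtain ⟨u, hu⟩ := (tendsto_stdNormalCdf_atBot.eventually_lt_const h0).exists
  obtain ⟨v, hv⟩ := (tendsto_stdNormalCdf_atTop.eventually_const_lt h1).exists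
  exact Function.invFun_eq
    (mem_range_of_exists_le_of_exists_ge continuous_stdNormalCdf ⟨u, hu.le⟩ ⟨v, hv.le⟩)

lemma stdNormalTail_normB {n : ℕ} (hn : 2 ≤ n) : stdNormalTail (normB n) = 1 / n := by
  have h2 : (2 : ℝ) ≤ n := by exact_mod_cast hn
  rw [stdNormalTail, normB, stdNormalCdf_stdNormalCdfInv]
  · ring
  · rw [sub_pos, div_lt_one (by linarith)]; linarith
  · have : (0 : ℝ) < 1 / n := by positivity
    linarith

lemma cumHazard_normB {n : ℕ} (hn : 2 ≤ n) : cumHazard (normB n) = Real.log n := by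
  rw [cumHazard, stdNormalTail_normB hn, one_div, Real.log_inv, neg_neg]

lemma le_normB {n m : ℕ} (hm : 2 ≤ m) (hmn : m ≤ n) {c : ℝ} (h : 1 / (m : ℝ) ≤ stdNormalTail c) :
    c ≤ normB n := by
  have hm0 : (0 : ℝ) < m := by exact_mod_cast (by omega : 0 < m)
  rw [← strictAnti_stdNormalTail.le_iff_ge, stdNormalTail_normB (hm.trans hmn)]
  exact (one_div_le_one_div_of_le hm0 (by exact_mod_cast hmn)).trans h

lemma sqrt_two_pi_lower : 2.5 ≤ Real.sqrt (2 * Real.pi) :=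
  Real.le_sqrt_of_sq_le (by linarith [Real.pi_gt_d2])

lemma sqrt_two_pi_upper : Real.sqrt (2 * Real.pi) ≤ 2.51 :=
  Real.sqrt_le_iff.2 ⟨by norm_num, by linarith [Real.pi_lt_d2]⟩

lemma exp_neg_le_quadratic {z : ℝ} (hz : 0 ≤ z) : Real.exp (-z) ≤ 1 - z + z ^ 2 / 2 := by
  rw [Real.exp_neg, inv_le_iff_one_le_mul₀ (Real.exp_pos z)]
  have h := Real.quadratic_le_exp_of_nonneg hz
  nlinarith [mul_le_mul_of_nonneg_left h (by nlinarith [sq_nonneg (z - 1)] : 0 ≤ 1 - z + z ^ 2 / 2),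
    sq_nonneg (z ^ 2)]

/-- Integrates `e^{-z} ≤ 1 - z + z² / 2` at `z = t² / 2`. Needed near 0.82, where Birnbaum's bound
is too weak to give tail `≥ 1/5`. -/
lemma stdNormalCdf_le {t : ℝ} (ht : 0 ≤ t) :
    stdNormalCdf t ≤ 1 / 2 + (Real.sqrt (2 * Real.pi))⁻¹ * (t - t ^ 3 / 6 + t ^ 5 / 40) := by
  set k := (Real.sqrt (2 * Real.pi))⁻¹ with hk
  have hd : ∀ x, HasDerivAt (fun x => stdNormalCdf x - k * (x - x ^ 3 / 6 + x ^ 5 / 40))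
      (stdNormalPdf x - k * (1 - x ^ 2 / 2 + x ^ 4 / 8)) x := by
    intro x
    refine (hasDerivAt_stdNormalCdf x).sub (HasDerivAt.const_mul k ?_)
    refine (((hasDerivAt_id x).sub ((hasDerivAt_pow 3 x).div_const 6)).add
      ((hasDerivAt_pow 5 x).div_const 40)).congr_deriv ?_
    norm_num
    ring
  have hanti : AntitoneOn (fun x => stdNormalCdf x - k * (x - x ^ 3 / 6 + x ^ 5 / 40))
      (Set.Ici 0) := by
    refine antitoneOn_of_deriv_nonpos (convex_Ici 0)
      (fun x _ => (hd x).continuousAt.continuousWithinAt)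
      (fun x _ => (hd x).differentiableAt.differentiableWithinAt) fun x _ => ?_
    rw [(hd x).deriv, sub_nonpos, stdNormalPdf, ← hk]
    gcongr
    have := exp_neg_le_quadratic (z := x ^ 2 / 2) (by positivity)
    rw [neg_div]
    linarith
  have h := hanti (Set.mem_Ici.2 le_rfl) (Set.mem_Ici.2 ht) ht
  norm_num [stdNormalCdf_zero] at h
  linarith

lemma normB_ge_of_five_le {n : ℕ} (hn : 5 ≤ n) : 0.82 ≤ normB n := by
  refine le_normB (by norm_num) hn ?_
  have h := stdNormalCdf_le (t := 0.82) (by norm_num)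
  have h1 : (Real.sqrt (2 * Real.pi))⁻¹ ≤ 2.5⁻¹ := inv_anti₀ (by norm_num) sqrt_two_pi_lower
  unfold stdNormalTail
  norm_num at *
  linarith

lemma pdf_mul_lt_stdNormalTail {t : ℝ} (ht : 0 < t) :
    stdNormalPdf t * (t / (t ^ 2 + 1)) < stdNormalTail t := by
  have h := hazard_mul_lt t
  rw [hazard, div_mul_eq_mul_div, div_lt_iff₀ (stdNormalTail_pos t)] at h
  rw [← mul_div_assoc, div_lt_iff₀ (by positivity)]
  linarith

lemma normB_ge_of_sixteen_le {n : ℕ} (hn : 16 ≤ n) : 1.44 ≤ normB n := by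
  refine le_normB (by norm_num) hn (le_trans ?_ (pdf_mul_lt_stdNormalTail (by norm_num)).le)
  have h1 : 2.51⁻¹ ≤ (Real.sqrt (2 * Real.pi))⁻¹ :=
    inv_anti₀ (by linarith [sqrt_two_pi_lower]) sqrt_two_pi_upper
  have h2 : 0.35 ≤ Real.exp (-1.44 ^ 2 / 2) := by
    have h3 : (0.367 : ℝ) ≤ Real.exp (-1) := by
      rw [Real.exp_neg, le_inv_comm₀ (by norm_num) (Real.exp_pos _)]
      exact Real.exp_one_lt_d9.le.trans (by norm_num)
    have h4 : Real.exp (-1.44 ^ 2 / 2) = Real.exp (-1) * Real.exp (-0.0368) := by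
      rw [← Real.exp_add]; norm_num
    have h5 := Real.one_sub_le_exp_neg 0.0368
    rw [h4]
    nlinarith
  calc 1 / ((16 : ℕ) : ℝ) ≤ 2.51⁻¹ * 0.35 * (1.44 / (1.44 ^ 2 + 1)) := by norm_num
    _ ≤ stdNormalPdf 1.44 * (1.44 / (1.44 ^ 2 + 1)) := by
      unfold stdNormalPdf
      gcongr

/-! ### The error bound for a single `n`. -/

lemma gumbelError_le_add {n : ℕ} (hn : 2 ≤ n) (x : ℝ) :
    gumbelError n x ≤ 4 * Real.exp (-2) / n
      + |Real.exp (-Real.exp (-tailDecrement (normB n) x)) - gumbelCdf x| := by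
  have hn0 : (0 : ℝ) < n := by exact_mod_cast (by omega : 0 < n)
  set q := stdNormalTail (normA n * x + normB n) with hq
  have h1 := abs_one_sub_pow_sub_exp_le (stdNormalTail_pos _).le
    (stdNormalTail_le_one (normA n * x + normB n)) (n := n) (by omega)
  -- Uses `cumHazard (normB n) = log n`.
  have h2 : Real.exp (-tailDecrement (normB n) x) = n * q := by
    rw [tailDecrement, neg_sub, sub_eq_add_neg, Real.exp_add, exp_neg_cumHazard,
      cumHazard_normB hn, Real.exp_log hn0]
    rfl
  have h3 : 1 - stdNormalTail (normA n * x + normB n)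
      = stdNormalCdf (normA n * x + normB n) := by
    unfold stdNormalTail; ring
  rw [h3] at h1
  rw [h2]
  exact (abs_sub_le _ (Real.exp (-(n * q))) _).trans (add_le_add_left h1 _)

lemma gumbelError_le_of_five_le {n : ℕ} (hn : 5 ≤ n) (x : ℝ) :
    gumbelError n x ≤ 0.54136 / n + 0.305 := by
  refine (gumbelError_le_add (by omega) x).trans (add_le_add ?_
    (abs_exp_neg_exp_tailDecrement_sub_gumbelCdf_le_of_small (normB_ge_of_five_le hn) x))
  gcongr
  linarith [exp_neg_two_lt]

lemma gumbelError_le_of_sixteen_le {n : ℕ} (hn : 16 ≤ n) (x : ℝ) :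
    gumbelError n x ≤ 0.54136 / n + 0.6 / normB n ^ 2 := by
  refine (gumbelError_le_add (by omega) x).trans (add_le_add ?_
    (abs_exp_neg_exp_tailDecrement_sub_gumbelCdf_le (normB_ge_of_sixteen_le hn) x))
  gcongr
  linarith [exp_neg_two_lt]

/-- An unbounded real `⨆` would default to 0, so the supremum bound has content only together with
this. -/
lemma bddAbove_range_gumbelError {n : ℕ} (hn : 5 ≤ n) :
    BddAbove (Set.range (gumbelError n)) :=
  ⟨_, by rintro _ ⟨x, rfl⟩; exact gumbelError_le_of_five_le hn x⟩

lemma iSup_gumbelError_lt_of_le_fifteen {n : ℕ} (hn : 5 ≤ n) (hn' : n ≤ 15) :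
    (⨆ x, gumbelError n x) < 1 / Real.log n := by
  refine (ciSup_le (gumbelError_le_of_five_le hn)).trans_lt ?_
  have hn5 : (5 : ℝ) ≤ n := by exact_mod_cast hn
  have hlog : 0 < Real.log n := Real.log_pos (by linarith)
  -- The `n = 5` bound, about 0.413, exceeds `1 / log 15`, so the range is split.
  rcases le_or_gt n 8 with h8 | h9
  · have h1 : Real.log n ≤ 2.08 := by
      calc Real.log n ≤ Real.log (2 ^ 3) :=
            Real.log_le_log (by linarith) (by norm_num; exact_mod_cast h8)
        _ = 3 * Real.log 2 := by rw [Real.log_pow]; norm_num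
        _ ≤ _ := by linarith [Real.log_two_lt_d9]
    calc 0.54136 / (n : ℝ) + 0.305 ≤ 0.54136 / 5 + 0.305 := by gcongr
      _ < 1 / 2.08 := by norm_num
      _ ≤ _ := by gcongr
  · have h9' : (9 : ℝ) ≤ n := by exact_mod_cast h9
    have h1 : Real.log n ≤ 2.72 := by
      rw [Real.log_le_iff_le_exp (by linarith)]
      refine le_of_pow_le_pow_left₀ (n := 25) (by norm_num) (Real.exp_pos _).le ?_
      calc (n : ℝ) ^ 25 ≤ 15 ^ 25 := by gcongr; exact_mod_cast hn'
        _ ≤ 2.7182818283 ^ 68 := by norm_num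
        _ ≤ Real.exp 1 ^ 68 := by gcongr; exact Real.exp_one_gt_d9.le
        _ = Real.exp 2.72 ^ 25 := by rw [← Real.exp_nat_mul, ← Real.exp_nat_mul]; norm_num
    calc 0.54136 / (n : ℝ) + 0.305 ≤ 0.54136 / 9 + 0.305 := by gcongr
      _ < 1 / 2.72 := by norm_num
      _ ≤ _ := by gcongr

lemma sqrt_exp_one_lt : Real.sqrt (Real.exp 1) < 1.65 :=
  (Real.sqrt_lt' (by norm_num)).2 (Real.exp_one_lt_d9.trans (by norm_num))

lemma sqrt_exp_one_gt : 1.64 < Real.sqrt (Real.exp 1) :=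
  Real.lt_sqrt_of_sq_lt (lt_trans (by norm_num) Real.exp_one_gt_d9)

lemma iSup_gumbelError_lt_of_sixteen_le {n : ℕ} (hn : 16 ≤ n) :
    (⨆ x, gumbelError n x) < rateC n / Real.log n := by
  refine (ciSup_le (gumbelError_le_of_sixteen_le hn)).trans_lt ?_
  have hn0 : (16 : ℝ) ≤ n := by exact_mod_cast hn
  have hlog : 0 < Real.log n := Real.log_pos (by linarith)
  have hb := normB_ge_of_sixteen_le hn
  have hb0 : 0 < normB n := by linarith
  rw [rateC, if_neg (by omega), mul_div_cancel_right₀ _ hlog.ne', add_comm]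
  refine add_lt_add ?_ ?_
  · rw [div_lt_div_iff₀ (by positivity) (by positivity)]
    nlinarith [sq_pos_of_pos hb0]
  · have hs := sqrt_exp_one_lt
    have hs0 := sqrt_exp_one_gt
    have hp : 0 < Real.sqrt (Real.exp 1) * n := by positivity
    rw [div_lt_div_iff₀ (by linarith) hp]
    nlinarith

/-! ### Monotonicity and limit of `C`. -/

lemma hazard_eq (t : ℝ) : stdNormalTail t = stdNormalPdf t / hazard t := by
  have := (stdNormalPdf_pos t).ne'
  have := (stdNormalTail_pos t).ne'
  unfold hazard
  field_simp

lemma cumHazard_eq (t : ℝ) :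
    cumHazard t = t ^ 2 / 2 + Real.log (Real.sqrt (2 * Real.pi)) + Real.log (hazard t) := by
  have h0 : Real.sqrt (2 * Real.pi) ≠ 0 := by linarith [sqrt_two_pi_lower]
  rw [cumHazard, hazard_eq, Real.log_div (stdNormalPdf_pos t).ne' (hazard_pos t).ne',
    stdNormalPdf, Real.log_mul (inv_ne_zero h0) (Real.exp_pos _).ne', Real.log_exp, Real.log_inv]
  ring

/-- The derivative has the sign of `t h - 2 H`. Here `t h < t² + 1`, while `2 H ≥ t² + 1` because
`log √(2π) ≥ 1/2` and `h ≥ t ≥ 1`. -/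
lemma antitoneOn_cumHazard_div_sq :
    AntitoneOn (fun t => cumHazard t / t ^ 2) (Set.Ici 1) := by
  have hd : ∀ x : ℝ, 1 ≤ x → HasDerivAt (fun t => cumHazard t / t ^ 2)
      ((hazard x * x ^ 2 - cumHazard x * (2 * x)) / (x ^ 2) ^ 2) x := by
    intro x hx
    refine ((hasDerivAt_cumHazard x).div (hasDerivAt_pow 2 x) (by positivity)).congr_deriv ?_
    norm_num
  refine antitoneOn_of_deriv_nonpos (convex_Ici 1)
    (fun x hx => (hd x hx).continuousAt.continuousWithinAt)
    (fun x hx => (hd x (interior_subset hx)).differentiableAt.differentiableWithinAt)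
    fun x hx => ?_
  have hx1 : 1 ≤ x := Set.mem_Ici.1 (interior_subset hx)
  rw [(hd x hx1).deriv]
  refine div_nonpos_of_nonpos_of_nonneg ?_ (by positivity)
  have h1 : 1 / 2 ≤ Real.log (Real.sqrt (2 * Real.pi)) := by
    rw [Real.le_log_iff_exp_le (by linarith [sqrt_two_pi_lower]), Real.exp_half]
    linarith [sqrt_two_pi_lower, sqrt_exp_one_lt]
  have h2 : 0 ≤ Real.log (hazard x) := Real.log_nonneg (hx1.trans (lt_hazard x).le)
  have h3 := cumHazard_eq x
  have h4 := hazard_mul_lt x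
  nlinarith

lemma rateC_eq {n : ℕ} (hn : 16 ≤ n) :
    rateC n = 2 / 3 * (cumHazard (normB n) / normB n ^ 2)
      + (Real.sqrt (Real.exp 1))⁻¹ * (Real.log n / n) := by
  rw [rateC, if_neg (by omega), cumHazard_normB (by omega)]
  have : (n : ℝ) ≠ 0 := by positivity
  have : normB n ≠ 0 := by linarith [normB_ge_of_sixteen_le hn]
  have : Real.sqrt (Real.exp 1) ≠ 0 := by linarith [sqrt_exp_one_gt]
  field_simp

lemma rateC_antitone {m n : ℕ} (hm : 16 ≤ m) (hmn : m ≤ n) : rateC n ≤ rateC m := by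
  have hm0 : (16 : ℝ) ≤ m := by exact_mod_cast hm
  have hn0 : (16 : ℝ) ≤ n := by exact_mod_cast hm.trans hmn
  have he : Real.exp 1 ≤ 16 := Real.exp_one_lt_d9.le.trans (by norm_num)
  have hbm := normB_ge_of_sixteen_le hm
  have hbn := normB_ge_of_sixteen_le (hm.trans hmn)
  rw [rateC_eq hm, rateC_eq (hm.trans hmn)]
  have h1 : normB m ≤ normB n := le_normB (by omega) hmn (stdNormalTail_normB (by omega)).ge
  have h2 := antitoneOn_cumHazard_div_sq (Set.mem_Ici.2 (by linarith : (1 : ℝ) ≤ normB m))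
    (Set.mem_Ici.2 (by linarith : (1 : ℝ) ≤ normB n)) h1
  have h3 := Real.log_div_self_antitoneOn (he.trans hm0) (he.trans hn0)
    (by exact_mod_cast hmn : (m : ℝ) ≤ n)
  simp only at h2 h3
  gcongr

lemma rateC_lt_one {n : ℕ} (hn : 16 ≤ n) : rateC n < 1 := by
  refine (rateC_antitone le_rfl hn).trans_lt ?_
  have hb := normB_ge_of_sixteen_le (le_refl 16)
  have hb2 : 2.07 ≤ normB 16 ^ 2 := by nlinarith
  have hl : Real.log ((16 : ℕ) : ℝ) ≤ 2.7728 := by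
    calc Real.log ((16 : ℕ) : ℝ) = Real.log (2 ^ 4) := by norm_num
      _ = 4 * Real.log 2 := by rw [Real.log_pow]; norm_num
      _ ≤ _ := by linarith [Real.log_two_lt_d9]
  have hl0 : 0 ≤ Real.log ((16 : ℕ) : ℝ) := Real.log_natCast_nonneg 16
  rw [rateC, if_neg (by norm_num)]
  -- This value is about 0.9987, so the constants leave little slack.
  calc _ ≤ (2 / (3 * 2.07) + 1 / (1.64 * ((16 : ℕ) : ℝ))) * 2.7728 := by
        gcongr
        exact sqrt_exp_one_gt.le
    _ < 1 := by norm_num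

/-- By `cumHazard_eq` only `log h = o(t²)` is needed, and `1 ≤ h ≤ e t²` for `t ≥ 1`. -/
lemma tendsto_cumHazard_div_sq : Tendsto (fun t => cumHazard t / t ^ 2) atTop (𝓝 (1 / 2)) := by
  set c := Real.log (Real.sqrt (2 * Real.pi)) with hc
  have hsq : Tendsto (fun t : ℝ => t ^ 2) atTop atTop := tendsto_pow_atTop two_ne_zero
  have hlog : Tendsto (fun t => Real.log (hazard t) / t ^ 2) atTop (𝓝 0) := by
    have h1 : Tendsto (fun t : ℝ => Real.log (t ^ 2) / t ^ 2 + (t ^ 2)⁻¹) atTop (𝓝 (0 + 0)) := by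
      refine Tendsto.add ?_ (tendsto_inv_atTop_zero.comp hsq)
      exact (Real.isLittleO_log_id_atTop.tendsto_div_nhds_zero).comp hsq
    rw [add_zero] at h1
    refine squeeze_zero' ?_ ?_ h1
    · filter_upwards [eventually_ge_atTop 1] with t ht
      exact div_nonneg (Real.log_nonneg (ht.trans (lt_hazard t).le)) (by positivity)
    · filter_upwards [eventually_ge_atTop 1] with t ht
      rw [← one_div, ← add_div]
      gcongr
      have h2 : hazard t ≤ t ^ 2 * Real.exp 1 := by
        nlinarith [hazard_mul_lt t, hazard_pos t, Real.exp_one_gt_two]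
      calc Real.log (hazard t) ≤ Real.log (t ^ 2 * Real.exp 1) :=
            Real.log_le_log (hazard_pos t) h2
        _ = _ := by rw [Real.log_mul (by positivity) (Real.exp_pos 1).ne', Real.log_exp]
  have h3 : Tendsto (fun t : ℝ => 1 / 2 + c * (t ^ 2)⁻¹ + Real.log (hazard t) / t ^ 2) atTop
      (𝓝 (1 / 2 + c * 0 + 0)) :=
    ((tendsto_inv_atTop_zero.comp hsq).const_mul c |>.const_add _).add hlog
  simp only [mul_zero, add_zero] at h3
  refine h3.congr' ?_
  filter_upwards [eventually_ge_atTop 1] with t ht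
  rw [cumHazard_eq, ← hc]
  have : t ≠ 0 := by positivity
  field_simp

lemma tendsto_normB : Tendsto normB atTop atTop := by
  refine tendsto_atTop.2 fun c => ?_
  obtain ⟨m, hm⟩ := exists_nat_one_div_lt (stdNormalTail_pos c)
  filter_upwards [eventually_ge_atTop (m + 2)] with n hn
  refine le_normB (by omega) hn (le_trans ?_ hm.le)
  push_cast
  gcongr
  norm_num

lemma tendsto_rateC : Tendsto rateC atTop (𝓝 (1 / 3)) := by
  have h1 := (tendsto_cumHazard_div_sq.comp tendsto_normB).const_mul (2 / 3)
  have h2 := ((Real.isLittleO_log_id_atTop.tendsto_div_nhds_zero).comp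
    tendsto_natCast_atTop_atTop).const_mul (Real.sqrt (Real.exp 1))⁻¹
  have h3 := h1.add h2
  norm_num at h3
  refine h3.congr' ?_
  filter_upwards [eventually_ge_atTop 16] with n hn
  rw [rateC_eq hn]

end

theorem theorem1 :
    (∀ n₀ : ℕ, 5 ≤ n₀ → ∀ n : ℕ, n₀ ≤ n →
      BddAbove (Set.range (gumbelError n)) ∧
        (⨆ x : ℝ, gumbelError n x) < rateC n₀ / Real.log (n : ℝ)) ∧
    (∀ n₀ : ℕ, 16 ≤ n₀ → rateC n₀ < 1) ∧
    Tendsto rateC atTop (𝓝 (1 / 3)) := by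
  refine ⟨fun n₀ h₀ n hn => ⟨bddAbove_range_gumbelError (h₀.trans hn), ?_⟩,
    fun n₀ h₀ => rateC_lt_one h₀, tendsto_rateC⟩
  have hlog : 0 ≤ Real.log (n : ℝ) := Real.log_natCast_nonneg n
  rcases le_or_gt n₀ 15 with h15 | h16
  · have hC : rateC n₀ = 1 := if_pos h15
    rw [hC]
    -- With `n₀ ≤ 15 < n`, the bound `C(n) / log n` is still below `1 / log n`.
    rcases le_or_gt n 15 with hn15 | hn16
    · exact iSup_gumbelError_lt_of_le_fifteen (h₀.trans hn) hn15
    · exact (iSup_gumbelError_lt_of_sixteen_le hn16).trans_le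
        (div_le_div_of_nonneg_right (rateC_lt_one hn16).le hlog)
  · exact (iSup_gumbelError_lt_of_sixteen_le (le_trans h16 hn)).trans_le
      (div_le_div_of_nonneg_right (rateC_antitone h16 hn) hlog)
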